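/- Let $(Y_1,\mathcal Y_1,\nu_1)$ and $(Y_2,\mathcal Y_2,\nu_2)$ be probability spaces and, for $i=1,2$, let $S_i\colon Y_i\to Y_i$ be an invertible measure preserving transformation (a bijection that is measurable together with its inverse and preserves $\nu_i$) which is ergodic. Let $(X,\mathcal X,\mu)=(Y_1\times Y_2,\mathcal Y_1\otimes\mathcal Y_2,\nu_1\times\nu_2)$ be the product measure space, and let $T_1=S_1\times\mathrm{id}$ and $T_2=\mathrm{id}\times S_2$. Let $A\in\mathcal X$ with $\mu(A)>0$. Then for every $\epsilon>0$ the set $$\{n\in\mathbb Z\colon\ \mu(A\cap T_1^nA\cap T_2^nA)>\mu(A)^3-\epsilon\}$$ is syndetic, that is, there is an integer $N>0$ such that this set meets $[M,M+N)$ for every $M\in\mathbb Z$. -/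

import Mathlib

/-- A set `E` of integers is syndetic if for some integer `N > 0` it meets every interval
`[M, M + N)`. -/
def IsSyndetic (E : Set ℤ) : Prop :=
  ∃ N : ℤ, 0 < N ∧ ∀ M : ℤ, (E ∩ Set.Ico M (M + N)).Nonempty

/-- The `n`-th iterate, `n ∈ ℤ`, of an invertible bimeasurable transformation, as a bijection. -/
def MeasurableEquiv.iter {X : Type*} [MeasurableSpace X] (T : X ≃ᵐ X) (n : ℤ) : X ≃ X :=
  (T.toEquiv : Equiv.Perm X) ^ n

open Filter Topology MeasureTheory

/-! It suffices that the set of good `n` belongs to every idempotent ultrafilter `e` on `ℤ`: a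
non-syndetic set has thick complement, and thickness produces an idempotent containing the
complement.

Along `e`, the indicators of `T₁^n A` and `T₂^n A` converge weakly to functions `h` and `k` with
values in `[0, 1]`. Idempotence makes these limits strongly recurrent, `U^n v → v`, so they act like
conditional expectations of `1_A`: a Lipschitz function of `h` is again recurrent, which gives `∫_A
(h + δ)⁻¹ = ∫ h (h + δ)⁻¹ ≤ 1`; the shift `δ > 0` allows for zeros of `h`.

The product structure gives `μ(A ∩ T₁^n A ∩ T₂^n A) → ∫_A h k` along `e`. For rectangles the two
translates meet in a rectangle whose sides move separately; the general case follows by additivity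
and domination by `μ`.

Finally, with `p = μ(A)`, integrating `h k / p² + p / h + p / k ≥ 3` over `A` (after the shift by
`δ`) gives `∫_A h k ≥ p³`. -/

/-- An ultrafilter `e` on `ℤ` is idempotent if `e + e = e`. -/
def Ultrafilter.IsAddIdempotent (e : Ultrafilter ℤ) : Prop :=
  ∀ p : ℤ → Prop, (∀ᶠ n in (e : Filter ℤ), p n) ↔
    ∀ᶠ m in (e : Filter ℤ), ∀ᶠ n in (e : Filter ℤ), p (m + n)

/-! ### Idempotent ultrafilters and syndetic sets -/

section Semigroup

attribute [local instance] Ultrafilter.add Ultrafilter.addSemigroup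

/-- A set of integers that belongs to every idempotent ultrafilter is syndetic. -/
theorem isSyndetic_of_forall_isAddIdempotent {E : Set ℤ}
    (hE : ∀ e : Ultrafilter ℤ, e.IsAddIdempotent → E ∈ (e : Filter ℤ)) : IsSyndetic E := by
  by_contra hns
  have hthick : ∀ N : ℤ, 0 < N → ∃ M : ℤ, ∀ n ∈ Set.Ico M (M + N), n ∉ E := by
    intro N hN
    by_contra! h
    refine hns ⟨N, hN, fun M => ?_⟩
    obtain ⟨n, hn, hnE⟩ := h M
    exact ⟨n, hnE, hn⟩
  let L : Set (Ultrafilter ℤ) := {q | ∀ k : ℤ, {n : ℤ | n + k ∉ E} ∈ (q : Filter ℤ)}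
  have hclosed : IsClosed L := by
    have : L = ⋂ k : ℤ, {q : Ultrafilter ℤ | {n : ℤ | n + k ∉ E} ∈ q} := by
      ext q; simp [L]
    rw [this]
    exact isClosed_iInter fun k => ultrafilter_isClosed_basic _
  have hne : L.Nonempty := by
    choose! M hM using hthick
    -- The centre of a gap of length `2 * j + 1`: all shifts by `|k| ≤ j` stay in the gap.
    let u : ℕ → ℤ := fun j => M (2 * j + 1) + j
    refine ⟨(hyperfilter ℕ).map u, fun k => ?_⟩
    change ∀ᶠ j in (hyperfilter ℕ : Filter ℕ), u j + k ∉ E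
    have : ∀ᶠ j : ℕ in atTop, u j + k ∉ E := by
      filter_upwards [eventually_ge_atTop k.natAbs] with j hj
      exact hM (2 * j + 1) (by positivity) _ ⟨by simp only [u]; omega, by simp only [u]; omega⟩
    exact Nat.hyperfilter_le_atTop this
  obtain ⟨e, heL, hee⟩ := exists_idempotent_in_compact_add_subsemigroup
    (Ultrafilter.continuous_add_left) L hne hclosed.isCompact (by
      intro p _ q hq k
      change ∀ᶠ m in (p : Filter ℤ), ∀ᶠ n in (q : Filter ℤ), m + n + k ∉ E
      refine Eventually.of_forall fun m => ?_
      filter_upwards [hq (m + k)] with n hn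
      rwa [show m + n + k = n + (m + k) by ring])
  have hidem : e.IsAddIdempotent := by
    intro p
    rw [← Ultrafilter.eventually_add, hee]
  have h1 := hE e hidem
  have h2 := heL 0
  have h3 := inter_mem h1 h2
  obtain ⟨n, hn1, hn2⟩ := Ultrafilter.nonempty_of_mem h3
  simp at hn2
  exact hn2 hn1

end Semigroup

/-! ### Weak limits and recurrence in Hilbert space -/

section Hilbert

variable {H : Type*} [NormedAddCommGroup H] [InnerProductSpace ℝ H]

open scoped InnerProductSpace

/-- A bounded family in a Hilbert space converges weakly along every ultrafilter. -/
theorem exists_tendsto_inner_of_norm_le [CompleteSpace H] {ι : Type*} (e : Ultrafilter ι)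
    (u : ι → H) (C : ℝ) (hu : ∀ i, ‖u i‖ ≤ C) :
    ∃ v : H, ∀ g : H, Tendsto (fun i => ⟪u i, g⟫_ℝ) e (𝓝 ⟪v, g⟫_ℝ) := by
  let w : ι → WeakDual ℝ H := fun i =>
    StrongDual.toWeakDual (InnerProductSpace.toDual ℝ H (u i))
  obtain ⟨x, -, hx⟩ := (WeakDual.isCompact_closedBall (𝕜 := ℝ) (E := H) 0 C).ultrafilter_le_nhds
    (e.map w) (by
      rw [le_principal_iff]
      refine Eventually.of_forall (f := (e : Filter ι)) fun i => ?_
      simpa [w] using hu i)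
  have hx' : Tendsto w e (𝓝 x) := hx
  refine ⟨(InnerProductSpace.toDual ℝ H).symm (WeakDual.toStrongDual x), fun g => ?_⟩
  rw [InnerProductSpace.toDual_symm_apply]
  exact ((WeakDual.eval_continuous g).tendsto x).comp hx'

/-- Weak limits of an isometric action of `ℤ` along an idempotent ultrafilter are strongly
recurrent along it. -/
theorem tendsto_of_tendsto_inner_isAddIdempotent {e : Ultrafilter ℤ}
    (he : e.IsAddIdempotent) (U : ℤ → H →ₗᵢ[ℝ] H) (hU0 : ∀ u, U 0 u = u)
    (hU : ∀ m n u, U (m + n) u = U m (U n u)) {u v : H}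
    (huv : ∀ g : H, Tendsto (fun n => ⟪U n u, g⟫_ℝ) e (𝓝 ⟪v, g⟫_ℝ)) :
    Tendsto (fun n => U n v) e (𝓝 v) := by
  have adj : ∀ m (x g : H), ⟪U m x, g⟫_ℝ = ⟪x, U (-m) g⟫_ℝ := by
    intro m x g
    rw [← (U m).inner_map_map x, ← hU, add_neg_cancel, hU0]
  obtain ⟨l, -, hl⟩ := (isCompact_Icc (a := -(‖v‖ * ‖v‖)) (b := ‖v‖ * ‖v‖)).ultrafilter_le_nhds
    (e.map fun n => ⟪U n v, v⟫_ℝ) (by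
      rw [le_principal_iff]
      refine Eventually.of_forall (f := (e : Filter ℤ)) fun n => abs_le.1 ?_
      simpa using abs_real_inner_le_norm (U n v) v)
  have hl' : Tendsto (fun n => ⟪U n v, v⟫_ℝ) e (𝓝 l) := hl
  -- By idempotence `⟪U (m + n) u, v⟫` is near `⟪v, v⟫` for `e`-most `m`, then `e`-most `n`. It
  -- equals `⟪U n u, U (-m) v⟫`, whose limit in `n` is `⟪U m v, v⟫`, and this is near `l`.
  have hlv : l = ⟪v, v⟫_ℝ := by
    by_contra hne
    obtain ⟨δ, hδ, hlt⟩ : ∃ δ > 0, 3 * δ ≤ |l - ⟪v, v⟫_ℝ| :=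
      ⟨|l - ⟪v, v⟫_ℝ| / 3, by have := abs_pos.2 (sub_ne_zero.2 hne); positivity, by linarith⟩
    have h1 := (he _).1 ((Metric.tendsto_nhds.1 (huv v)) δ hδ)
    have h2 := Metric.tendsto_nhds.1 hl' δ hδ
    obtain ⟨m, hm1, hm2⟩ := (h1.and h2).exists
    have h3 := Metric.tendsto_nhds.1 (huv (U (-m) v)) δ hδ
    obtain ⟨n, hn1, hn2⟩ := (hm1.and h3).exists
    simp only [Real.dist_eq] at *
    rw [hU, adj] at hn1
    rw [← adj m v v] at hn2
    rw [abs_lt] at *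
    have : |l - ⟪v, v⟫_ℝ| < 3 * δ := by rw [abs_lt]; constructor <;> linarith
    linarith
  rw [tendsto_iff_norm_sub_tendsto_zero]
  have hsq : ∀ n, ‖U n v - v‖ ^ 2 = 2 * ⟪v, v⟫_ℝ - 2 * ⟪U n v, v⟫_ℝ := by
    intro n
    rw [norm_sub_sq_real, (U n).norm_map, real_inner_self_eq_norm_sq]; ring
  have h0 : Tendsto (fun n => ‖U n v - v‖ ^ 2) e (𝓝 0) := by
    simp_rw [hsq]
    have := (tendsto_const_nhds (x := 2 * ⟪v, v⟫_ℝ)).sub (hl'.const_mul 2)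
    rw [hlv, sub_self] at this
    exact this
  have := h0.sqrt
  simpa using this

end Hilbert

/-! ### Extension of limits from rectangles -/

section Pi

variable {X Y : Type*} [MeasurableSpace X] [MeasurableSpace Y]

/-- Convergence of uniformly absolutely continuous finitely additive set functions may be checked
on rectangles. -/
theorem tendsto_of_tendsto_rectangles {ι : Type*} {l : Filter ι} (μ : Measure (X × Y))
    [IsFiniteMeasure μ] (φ : ι → Set (X × Y) → ℝ) (ψ : Set (X × Y) → ℝ)
    (hφ : ∀ i s t, MeasurableSet s → MeasurableSet t → Disjoint s t →
      φ i (s ∪ t) = φ i s + φ i t)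
    (hψ : ∀ s t, MeasurableSet s → MeasurableSet t → Disjoint s t → ψ (s ∪ t) = ψ s + ψ t)
    (hφb : ∀ i s, MeasurableSet s → |φ i s| ≤ μ.real s)
    (hψb : ∀ s, MeasurableSet s → |ψ s| ≤ μ.real s)
    (hrect : ∀ s t, MeasurableSet s → MeasurableSet t →
      Tendsto (fun i => φ i (s ×ˢ t)) l (𝓝 (ψ (s ×ˢ t)))) {A : Set (X × Y)}
    (hA : MeasurableSet A) : Tendsto (fun i => φ i A) l (𝓝 (ψ A)) := by
  have hempty : Tendsto (fun i => φ i ∅) l (𝓝 (ψ ∅)) := by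
    simpa using hrect ∅ ∅ .empty .empty
  induction A, hA using MeasurableSpace.induction_on_inter generateFrom_prod.symm
    isPiSystem_prod with
  | empty => exact hempty
  | basic t ht =>
    obtain ⟨a, ha, b, hb, rfl⟩ := ht
    exact hrect a b ha hb
  | compl t ht ih =>
    have h1 : ∀ i, φ i tᶜ = φ i (Set.univ ×ˢ Set.univ) - φ i t := fun i => by
      have := hφ i t tᶜ ht ht.compl disjoint_compl_right
      rw [Set.union_compl_self] at this
      rw [Set.univ_prod_univ]; linarith
    have h2 : ψ tᶜ = ψ (Set.univ ×ˢ Set.univ) - ψ t := by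
      have := hψ t tᶜ ht ht.compl disjoint_compl_right
      rw [Set.union_compl_self] at this
      rw [Set.univ_prod_univ]; linarith
    simp_rw [h1, h2]
    exact (hrect _ _ .univ .univ).sub ih
  | iUnion f hd hf ih =>
    have hacc : ∀ N, MeasurableSet (Set.accumulate f N) := fun N =>
      by
      rw [Set.accumulate_def]; exact .biUnion (Set.to_countable _) fun i _ => hf i
    have hfin : ∀ N, Tendsto (fun i => φ i (Set.accumulate f N)) l
        (𝓝 (ψ (Set.accumulate f N))) := by
      intro N
      induction N with
      | zero => simpa [Set.accumulate_zero_nat] using ih 0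
      | succ N ihN =>
        have hdis : Disjoint (Set.accumulate f N) (f (N + 1)) :=
          Set.disjoint_accumulate hd (Nat.lt_succ_self N)
        simp_rw [Set.accumulate_succ]
        rw [hψ _ _ (hacc N) (hf _) hdis]
        simp_rw [fun i => hφ i _ _ (hacc N) (hf (N + 1)) hdis]
        exact ihN.add (ih _)
    have hU : MeasurableSet (⋃ i, f i) := .iUnion hf
    have hsub : ∀ N, Set.accumulate f N ⊆ ⋃ i, f i := fun N => by
      rw [← Set.iUnion_accumulate]; exact Set.subset_iUnion _ N
    have htail : Tendsto (fun N => μ.real ((⋃ i, f i) \ Set.accumulate f N)) atTop (𝓝 0) := by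
      have h1 : Tendsto (fun N => μ.real (Set.accumulate f N)) atTop (𝓝 (μ.real (⋃ i, f i))) :=
        (ENNReal.tendsto_toReal (measure_ne_top _ _)).comp tendsto_measure_iUnion_accumulate
      have h2 := (tendsto_const_nhds (x := μ.real (⋃ i, f i))).sub h1
      rw [sub_self] at h2
      refine h2.congr fun N => ?_
      rw [measureReal_sdiff (hsub N) (hacc N)]
    -- Domination by `μ` bounds the truncation error uniformly in `i`, so one `N` serves for all
    -- `i`.
    have hsplit : ∀ (χ : Set (X × Y) → ℝ), (∀ s t, MeasurableSet s → MeasurableSet t →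
        Disjoint s t → χ (s ∪ t) = χ s + χ t) → (∀ s, MeasurableSet s → |χ s| ≤ μ.real s) →
        ∀ N, |χ (⋃ i, f i) - χ (Set.accumulate f N)| ≤
          μ.real ((⋃ i, f i) \ Set.accumulate f N) := by
      intro χ h1 h2 N
      have := h1 _ _ (hacc N) (hU.diff (hacc N)) Set.disjoint_sdiff_right
      rw [Set.union_sdiff_cancel (hsub N)] at this
      rw [this, add_sub_cancel_left]
      exact h2 _ (hU.diff (hacc N))
    rw [Metric.tendsto_nhds]
    intro ε hε
    obtain ⟨N, hN⟩ := (htail.eventually (gt_mem_nhds (show 0 < ε / 3 by positivity))).exists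
    filter_upwards [Metric.tendsto_nhds.1 (hfin N) (ε / 3) (by positivity)] with i hi
    have e1 := hsplit (φ i) (hφ i) (hφb i) N
    have e2 := hsplit ψ hψ hψb N
    rw [Real.dist_eq] at *
    rw [abs_le] at e1 e2
    rw [abs_lt] at *
    constructor <;> linarith

end Pi

/-! ### Weak densities of moving sets -/

/-- `h` is the weak limit along `e` of the indicators of the sets `P n`. -/
structure IsWeakDensity {X : Type*} [MeasurableSpace X] (μ : Measure X) (e : Ultrafilter ℤ)
    (P : ℤ → Set X) (h : X → ℝ) : Prop where
  measurable : Measurable h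
  nonneg : ∀ x, 0 ≤ h x
  le_one : ∀ x, h x ≤ 1
  tendsto : ∀ D, MeasurableSet D →
    Tendsto (fun n => μ.real (P n ∩ D)) e (𝓝 (∫ x in D, h x ∂μ))

namespace IsWeakDensity

variable {X Y : Type*} [MeasurableSpace X] [MeasurableSpace Y] {μ : Measure X} {ν : Measure Y}
  {e : Ultrafilter ℤ} {P Q R : ℤ → Set X} {h k l : X → ℝ}

theorem norm_le (hh : IsWeakDensity μ e P h) (x : X) : ‖h x‖ ≤ 1 := by
  rw [Real.norm_of_nonneg (hh.nonneg x)]; exact hh.le_one x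

theorem integrable [IsFiniteMeasure μ] (hh : IsWeakDensity μ e P h) : Integrable h μ :=
  .of_bound hh.measurable.aestronglyMeasurable 1 (.of_forall hh.norm_le)

theorem ae_eq [IsFiniteMeasure μ] (hh : IsWeakDensity μ e P h) (hk : IsWeakDensity μ e P k) :
    h =ᵐ[μ] k :=
  hh.integrable.ae_eq_of_forall_setIntegral_eq _ _ hk.integrable fun s hs _ =>
    tendsto_nhds_unique (hh.tendsto s hs) (hk.tendsto s hs)

/-- Supplies the additivity in the set that extension from rectangles requires. -/
theorem ae_eq_add [IsFiniteMeasure μ] (hh : IsWeakDensity μ e P h) (hk : IsWeakDensity μ e Q k)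
    (hl : IsWeakDensity μ e R l) (hQ : ∀ n, MeasurableSet (Q n))
    (hPQ : ∀ n, Disjoint (P n) (Q n)) (hR : ∀ n, R n = P n ∪ Q n) :
    l =ᵐ[μ] fun x => h x + k x := by
  refine hl.integrable.ae_eq_of_forall_setIntegral_eq _ _ (hh.integrable.add hk.integrable)
    fun s hs _ => tendsto_nhds_unique (hl.tendsto s hs) ?_
  rw [integral_add hh.integrable.integrableOn hk.integrable.integrableOn]
  refine ((hh.tendsto s hs).add (hk.tendsto s hs)).congr fun n => ?_
  rw [hR, Set.union_inter_distrib_right, measureReal_union _ ((hQ n).inter hs)]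
  exact (hPQ n).mono Set.inter_subset_left Set.inter_subset_left

theorem integral_eq [IsFiniteMeasure μ] (hh : IsWeakDensity μ e P h) {c : ℝ}
    (hc : ∀ n, μ.real (P n) = c) : ∫ x, h x ∂μ = c := by
  have := hh.tendsto _ .univ
  simp only [Set.inter_univ, hc, setIntegral_univ] at this
  exact tendsto_nhds_unique this tendsto_const_nhds

theorem inter_const (hh : IsWeakDensity μ e P h) {c : Set X} (hc : MeasurableSet c) :
    IsWeakDensity μ e (fun n => P n ∩ c) (c.indicator h) where
  measurable := hh.measurable.indicator hc
  nonneg x := Set.indicator_nonneg (fun x _ => hh.nonneg x) x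
  le_one x := Set.indicator_apply_le' (fun _ => hh.le_one x) fun _ => zero_le_one
  tendsto D hD := by
    rw [setIntegral_indicator hc, Set.inter_comm D c]
    simpa only [Set.inter_assoc] using hh.tendsto _ (hc.inter hD)

theorem univ : IsWeakDensity μ e (fun _ => Set.univ) (fun _ => 1) where
  measurable := measurable_const
  nonneg _ := zero_le_one
  le_one _ := le_rfl
  tendsto D _ := by simp

theorem const {c : Set X} (hc : MeasurableSet c) :
    IsWeakDensity μ e (fun _ => c) (c.indicator fun _ => 1) := by
  simpa using univ.inter_const (μ := μ) (e := e) hc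

/-- Tested on a rectangle, both the measure and the integral factor; domination by the product
measure handles general test sets. -/
theorem prod [IsProbabilityMeasure μ] [IsProbabilityMeasure ν] {P' : ℤ → Set Y} {h' : Y → ℝ}
    (hh : IsWeakDensity μ e P h) (hh' : IsWeakDensity ν e P' h')
    (hP : ∀ n, MeasurableSet (P n)) (hP' : ∀ n, MeasurableSet (P' n)) :
    IsWeakDensity (μ.prod ν) e (fun n => P n ×ˢ P' n) (fun z => h z.1 * h' z.2) where
  measurable := (hh.measurable.comp measurable_fst).mul (hh'.measurable.comp measurable_snd)
  nonneg z := mul_nonneg (hh.nonneg _) (hh'.nonneg _)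
  le_one z := mul_le_one₀ (hh.le_one _) (hh'.nonneg _) (hh'.le_one _)
  tendsto D hD := by
    have hint : Integrable (fun z : X × Y => h z.1 * h' z.2) (μ.prod ν) :=
      hh.integrable.mul_prod hh'.integrable
    have hnn : ∀ z : X × Y, 0 ≤ h z.1 * h' z.2 := fun z => mul_nonneg (hh.nonneg _) (hh'.nonneg _)
    refine tendsto_of_tendsto_rectangles (μ.prod ν)
      (fun n D => (μ.prod ν).real ((P n ×ˢ P' n) ∩ D))
      (fun D => ∫ z in D, h z.1 * h' z.2 ∂(μ.prod ν)) ?_ ?_ ?_ ?_ ?_ hD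
    · intro n s t hs ht hst
      rw [Set.inter_union_distrib_left, measureReal_union _ (((hP n).prod (hP' n)).inter ht)]
      exact hst.mono Set.inter_subset_right Set.inter_subset_right
    · intro s t _ ht hst
      exact setIntegral_union hst ht hint.integrableOn hint.integrableOn
    · intro n s _
      rw [abs_of_nonneg measureReal_nonneg]
      exact measureReal_mono Set.inter_subset_right
    · intro s _
      rw [abs_of_nonneg (integral_nonneg hnn)]
      calc ∫ z in s, h z.1 * h' z.2 ∂(μ.prod ν) ≤ ∫ _ in s, (1 : ℝ) ∂(μ.prod ν) :=
            integral_mono hint.integrableOn (integrable_const _) fun z =>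
              mul_le_one₀ (hh.le_one _) (hh'.nonneg _) (hh'.le_one _)
        _ = _ := by simp
    · intro s t hs ht
      rw [setIntegral_prod_mul]
      simp_rw [Set.prod_inter_prod, measureReal_prod_prod]
      exact (hh.tendsto s hs).mul (hh'.tendsto t ht)

end IsWeakDensity

/-- Post-composition with a Lipschitz function vanishing at `0` is continuous on `L²`. Subtracting
`δ⁻¹` gives the vanishing, and `max` removes the pole. -/
theorem lipschitzWith_inv_max_add {δ : ℝ} (hδ : 0 < δ) :
    LipschitzWith (Real.toNNReal (δ⁻¹ * δ⁻¹)) fun t : ℝ => (max t 0 + δ)⁻¹ - δ⁻¹ := by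
  refine LipschitzWith.of_dist_le_mul fun a b => ?_
  rw [Real.coe_toNNReal _ (by positivity), Real.dist_eq, Real.dist_eq, sub_sub_sub_cancel_right]
  have ha : 0 < max a 0 + δ := by positivity
  have hb : 0 < max b 0 + δ := by positivity
  rw [inv_sub_inv ha.ne' hb.ne', abs_div, div_eq_mul_inv, mul_comm, abs_of_pos (mul_pos ha hb),
    mul_inv]
  have h1 : (max a 0 + δ)⁻¹ ≤ δ⁻¹ := inv_anti₀ hδ (by simp)
  have h2 : (max b 0 + δ)⁻¹ ≤ δ⁻¹ := inv_anti₀ hδ (by simp)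
  have h3 : |max b 0 + δ - (max a 0 + δ)| ≤ |a - b| := by
    rw [add_sub_add_right_eq_sub, abs_sub_comm]
    exact abs_max_sub_max_le_abs a b 0
  gcongr

/-- Along an idempotent ultrafilter, the translates of a measurable set under a measure preserving
action of `ℤ` have a weak density `h`, and integrals over the set of functions of `h`
are controlled as if `h` were a conditional expectation. -/
theorem exists_isWeakDensity {X : Type*} [MeasurableSpace X] (μ : Measure X)
    [IsProbabilityMeasure μ] {e : Ultrafilter ℤ} (he : e.IsAddIdempotent) (τ : ℤ → X → X)
    (hτ : ∀ n, MeasurePreserving (τ n) μ μ) (hτ0 : ∀ x, τ 0 x = x)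
    (hadd : ∀ m n x, τ (m + n) x = τ n (τ m x)) {B : Set X} (hB : MeasurableSet B) :
    ∃ h : X → ℝ, IsWeakDensity μ e (fun n => τ n ⁻¹' B) h ∧
      ∀ δ > 0, ∫ x in B, (h x + δ)⁻¹ ∂μ ≤ 1 := by
  let U : ℤ → Lp ℝ 2 μ →ₗᵢ[ℝ] Lp ℝ 2 μ := fun n => Lp.compMeasurePreservingₗᵢ ℝ (τ n) (hτ n)
  have hUcoe : ∀ n u, U n u =ᵐ[μ] u ∘ τ n := fun n u => Lp.coeFn_compMeasurePreserving u (hτ n)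
  have hU0 : ∀ u, U 0 u = u := by
    intro u
    refine Lp.ext ((hUcoe 0 u).trans (.of_forall fun x => ?_))
    simp [hτ0]
  have hU : ∀ m n u, U (m + n) u = U m (U n u) := by
    intro m n u
    refine Lp.ext ((hUcoe _ u).trans ?_)
    filter_upwards [hUcoe m (U n u), (hτ m).quasiMeasurePreserving.ae (hUcoe n u)] with x h1 h2
    rw [h1, Function.comp_apply, Function.comp_apply, h2, hadd, Function.comp_apply]
  let f : Lp ℝ 2 μ := indicatorConstLp 2 hB (measure_ne_top μ B) 1
  obtain ⟨v, hv⟩ := exists_tendsto_inner_of_norm_le e (fun n => U n f) ‖f‖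
    fun n => ((U n).norm_map f).le
  have hrec := tendsto_of_tendsto_inner_isAddIdempotent he U hU0 hU hv
  have hBn : ∀ n, MeasurableSet (τ n ⁻¹' B) := fun n => (hτ n).measurable hB
  have hUf : ∀ n, U n f = indicatorConstLp 2 (hBn n) (measure_ne_top μ _) 1 := by
    intro n
    exact (Lp.indicatorConstLp_compMeasurePreserving hB (measure_ne_top μ _) 1 (hτ n)).symm
  have hvi : Integrable v μ := (Lp.memLp v).integrable (by norm_num)
  have hlim : ∀ D, MeasurableSet D →
      Tendsto (fun n => μ.real (τ n ⁻¹' B ∩ D)) e (𝓝 (∫ x in D, v x ∂μ)) := by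
    intro D hD
    have := hv (indicatorConstLp 2 hD (measure_ne_top μ _) 1)
    rw [real_inner_comm, L2.inner_indicatorConstLp_one] at this
    refine this.congr fun n => ?_
    rw [real_inner_comm, L2.inner_indicatorConstLp_one, hUf]
    rw [setIntegral_indicatorConstLp hD]
    simp
  have hv0 : 0 ≤ᵐ[μ] v := ae_nonneg_of_forall_setIntegral_nonneg hvi fun s hs _ =>
    ge_of_tendsto' (hlim s hs) fun n => measureReal_nonneg
  have hv1 : v ≤ᵐ[μ] fun _ => 1 := by
    refine ae_le_of_forall_setIntegral_le hvi (integrable_const _) fun s hs _ => ?_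
    refine le_of_tendsto' (hlim s hs) fun n => ?_
    simpa using measureReal_mono Set.inter_subset_right
  -- Truncation turns the almost everywhere bounds on `v` into pointwise ones.
  let h : X → ℝ := fun x => max 0 (min 1 (v x))
  have hhv : h =ᵐ[μ] v := by
    filter_upwards [hv0, hv1] with x h0 h1
    simp only [h]
    rw [min_eq_right h1, max_eq_right (by exact h0)]
  have hhd : IsWeakDensity μ e (fun n => τ n ⁻¹' B) h :=
    { measurable := measurable_const.max
        (measurable_const.min (Lp.stronglyMeasurable v).measurable)
      nonneg := fun x => le_max_left _ _
      le_one := fun x => max_le zero_le_one (min_le_left _ _)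
      tendsto := fun D hD => by
        rw [setIntegral_congr_ae hD (hhv.mono fun x hx _ => hx)]; exact hlim D hD }
  refine ⟨h, hhd, fun δ hδ => ?_⟩
  have hLip := lipschitzWith_inv_max_add hδ
  have hz : (max (0 : ℝ) 0 + δ)⁻¹ - δ⁻¹ = 0 := by simp
  let g : Lp ℝ 2 μ := hLip.compLp hz v
  have hUg : ∀ n, U n g = hLip.compLp hz (U n v) := by
    intro n
    refine Lp.ext ((hUcoe n g).trans ?_)
    filter_upwards [hLip.coeFn_compLp hz (U n v), hUcoe n v,
      (hτ n).quasiMeasurePreserving.ae (hLip.coeFn_compLp hz v)] with x h1 h2 h3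
    rw [h1, Function.comp_apply, h3, Function.comp_apply, Function.comp_apply, h2,
      Function.comp_apply]
  have hUgt : Tendsto (fun n => U n g) e (𝓝 g) := by
    simp_rw [hUg]
    exact ((hLip.continuous_compLp hz).tendsto v).comp hrec
  -- `⟪f, g⟫ = ⟪U n f, U n g⟫`, where `U n f → v` weakly and `U n g → g` strongly.
  have hfg : inner ℝ f g = inner ℝ v g := by
    have h1 : Tendsto (fun n => inner ℝ (U n f) (U n g - g)) e (𝓝 0) := by
      have h2 : Tendsto (fun n => ‖f‖ * ‖U n g - g‖) e (𝓝 0) := by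
        simpa using (tendsto_iff_norm_sub_tendsto_zero.1 hUgt).const_mul ‖f‖
      refine squeeze_zero_norm (fun n => ?_) h2
      rw [← (U n).norm_map f]
      exact norm_inner_le_norm _ _
    have h3 := (hv g).add h1
    simp_rw [← inner_add_right, add_sub_cancel, LinearIsometry.inner_map_map] at h3
    simpa using tendsto_nhds_unique tendsto_const_nhds h3
  have hgh : g =ᵐ[μ] fun x => (h x + δ)⁻¹ - δ⁻¹ := by
    filter_upwards [hLip.coeFn_compLp hz v, hhv] with x h1 h2
    rw [h1, Function.comp_apply, ← h2, max_eq_left (hhd.nonneg x)]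
  have hinv : ∀ x, (h x + δ)⁻¹ ≤ δ⁻¹ := fun x => inv_anti₀ hδ (by linarith [hhd.nonneg x])
  have hpos : ∀ x, 0 < h x + δ := fun x => by linarith [hhd.nonneg x]
  have hii : Integrable (fun x => (h x + δ)⁻¹) μ := by
    refine .of_bound ((hhd.measurable.add_const δ).inv).aestronglyMeasurable δ⁻¹
      (.of_forall fun x => ?_)
    rw [Real.norm_of_nonneg (inv_nonneg.2 (hpos x).le)]
    exact hinv x
  have hhi : Integrable (fun x => h x * (h x + δ)⁻¹) μ :=
    hii.bdd_mul hhd.measurable.aestronglyMeasurable (.of_forall hhd.norm_le)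
  have e1 : inner ℝ f g = ∫ x in B, (h x + δ)⁻¹ ∂μ - μ.real B * δ⁻¹ := by
    rw [L2.inner_indicatorConstLp_one, setIntegral_congr_ae hB (hgh.mono fun x hx _ => hx),
      integral_sub hii.integrableOn (integrable_const _)]
    simp
  have hhB : ∫ x, h x ∂μ = μ.real B :=
    hhd.integral_eq fun n => (hτ n).measureReal_preimage hB.nullMeasurableSet
  have e2 : inner ℝ v g = ∫ x, h x * (h x + δ)⁻¹ ∂μ - μ.real B * δ⁻¹ := by
    rw [L2.inner_def, ← hhB, ← integral_mul_const, ← integral_sub hhi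
      (hhd.integrable.mul_const _)]
    refine integral_congr_ae ?_
    filter_upwards [hgh, hhv] with x h1 h2
    rw [h1, ← h2]
    simp only [RCLike.inner_apply, conj_trivial]
    ring
  have e3 : ∫ x in B, (h x + δ)⁻¹ ∂μ = ∫ x, h x * (h x + δ)⁻¹ ∂μ := by linarith
  rw [e3]
  calc ∫ x, h x * (h x + δ)⁻¹ ∂μ ≤ ∫ _, (1 : ℝ) ∂μ := by
        refine integral_mono hhi (integrable_const _) fun x => ?_
        simp only
        rw [← div_eq_mul_inv, div_le_one (hpos x)]
        linarith
    _ = 1 := by simp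

/-! ### Integer iterates -/

theorem measurableEquiv_iter_add {X : Type*} [MeasurableSpace X] (T : X ≃ᵐ X) (m n : ℤ) (x : X) :
    T.iter (m + n) x = T.iter m (T.iter n x) := by
  simp [MeasurableEquiv.iter, zpow_add]

theorem measurePreserving_iter {X : Type*} [MeasurableSpace X] {μ : Measure X} (T : X ≃ᵐ X)
    (hT : MeasurePreserving T μ μ) (n : ℤ) : MeasurePreserving (T.iter n) μ μ := by
  have key : ∀ n : ℕ, MeasurePreserving (T.iter n) μ μ ∧ MeasurePreserving (T.iter (-n)) μ μ := by
    intro n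
    induction n with
    | zero =>
      have : ⇑(T.iter 0) = id := rfl
      simp [this, MeasurePreserving.id]
    | succ n ih =>
      have h1 : ⇑(T.iter ((n + 1 : ℕ) : ℤ)) = T.iter n ∘ T := by
        ext x
        rw [Nat.cast_succ, measurableEquiv_iter_add]
        rfl
      have h2 : ⇑(T.iter (-((n + 1 : ℕ) : ℤ))) = T.iter (-n) ∘ T.symm := by
        ext x
        rw [Nat.cast_succ, neg_add, measurableEquiv_iter_add]
        rfl
      rw [h1, h2]
      exact ⟨ih.1.comp hT, ih.2.comp (hT.symm T)⟩
  obtain ⟨k, rfl | rfl⟩ := n.eq_nat_or_neg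
  exacts [(key k).1, (key k).2]

theorem iter_image {X : Type*} [MeasurableSpace X] (T : X ≃ᵐ X) (n : ℤ) (A : Set X) :
    T.iter n '' A = T.iter (-n) ⁻¹' A := by
  rw [(T.iter n).image_eq_preimage_symm]
  congr 2
  simp only [MeasurableEquiv.iter, zpow_neg]
  rfl

theorem iter_prodCongr {X Y : Type*} [MeasurableSpace X] [MeasurableSpace Y] (S : X ≃ᵐ X)
    (T : Y ≃ᵐ Y) (n : ℤ) : ⇑((S.prodCongr T).iter n) = Prod.map (S.iter n) (T.iter n) := by
  induction n using Int.induction_on with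
  | zero => rfl
  | succ n ih =>
    ext1 z
    rw [measurableEquiv_iter_add, ih]
    simp only [Prod.map, measurableEquiv_iter_add]
    rfl
  | pred n ih =>
    ext1 z
    rw [sub_eq_add_neg, measurableEquiv_iter_add, ih]
    simp only [Prod.map, measurableEquiv_iter_add]
    rfl

theorem iter_refl {X : Type*} [MeasurableSpace X] (n : ℤ) :
    ⇑((MeasurableEquiv.refl X).iter n) = id := by
  have : (MeasurableEquiv.refl X).iter n = (1 : Equiv.Perm X) := one_zpow n
  rw [this]
  rfl

/-! ### The cubic lower bound -/

/-- The arithmetic-geometric mean inequality for three numbers whose product is `1`. -/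
theorem three_le_of_pos {p a b : ℝ} (hp : 0 < p) (ha : 0 < a) (hb : 0 < b) :
    3 ≤ a * b / p ^ 2 + p * a⁻¹ + p * b⁻¹ := by
  obtain ⟨x, hx, hxa⟩ : ∃ x > 0, a = p * x ^ 2 :=
    ⟨√(a / p), by positivity, by rw [Real.sq_sqrt (by positivity)]; field_simp⟩
  obtain ⟨y, hy, hyb⟩ : ∃ y > 0, b = p * y ^ 2 :=
    ⟨√(b / p), by positivity, by rw [Real.sq_sqrt (by positivity)]; field_simp⟩
  -- With `t = x * y`, the numerator is `(x - y)² + t⁴ - 3 t² + 2 t`, and `t³ - 3 t + 2 = (t - 1)²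
  -- (t + 2)`.
  have h : a * b / p ^ 2 + p * a⁻¹ + p * b⁻¹ - 3 =
      ((x - y) ^ 2 + x * y * ((x * y - 1) ^ 2 * (x * y + 2))) / (x ^ 2 * y ^ 2) := by
    rw [hxa, hyb]
    field_simp
    ring
  have : 0 ≤ a * b / p ^ 2 + p * a⁻¹ + p * b⁻¹ - 3 := by rw [h]; positivity
  linarith

/-- If `h` and `k` behave like conditional expectations of the indicator of `A`, then
`∫_A h k ≥ μ(A)³`. -/
theorem pow_three_le_setIntegral_mul {X : Type*} [MeasurableSpace X] {μ : Measure X}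
    [IsProbabilityMeasure μ] {A : Set X} {h k : X → ℝ}
    (hm : Measurable h) (km : Measurable k) (h0 : ∀ x, 0 ≤ h x) (k0 : ∀ x, 0 ≤ k x)
    (h1 : ∀ x, h x ≤ 1) (k1 : ∀ x, k x ≤ 1)
    (hh : ∀ δ > 0, ∫ x in A, (h x + δ)⁻¹ ∂μ ≤ 1) (hk : ∀ δ > 0, ∫ x in A, (k x + δ)⁻¹ ∂μ ≤ 1) :
    μ.real A ^ 3 ≤ ∫ x in A, h x * k x ∂μ := by
  rcases (measureReal_nonneg (μ := μ) (s := A)).eq_or_lt with hp | hp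
  · rw [← hp, zero_pow three_ne_zero]
    exact integral_nonneg fun x => mul_nonneg (h0 x) (k0 x)
  set p := μ.real A
  have hp1 : p ≤ 1 := measureReal_le_one
  have hkn : ∀ x, ‖k x‖ ≤ 1 := fun x => by rw [Real.norm_of_nonneg (k0 x)]; exact k1 x
  have hhn : ∀ x, ‖h x‖ ≤ 1 := fun x => by rw [Real.norm_of_nonneg (h0 x)]; exact h1 x
  have ik : Integrable k μ := .of_bound km.aestronglyMeasurable 1 (.of_forall hkn)
  have ihk : Integrable (fun x => h x * k x) μ :=
    ik.bdd_mul hm.aestronglyMeasurable (.of_forall hhn)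
  have inv_int : ∀ (f : X → ℝ) (δ : ℝ), 0 < δ → Measurable f → (∀ x, 0 ≤ f x) →
      Integrable (fun x => (f x + δ)⁻¹) μ := by
    intro f δ hδ fm f0
    refine .of_bound ((fm.add_const δ).inv).aestronglyMeasurable δ⁻¹ (.of_forall fun x => ?_)
    have := f0 x
    rw [Real.norm_of_nonneg (by positivity)]
    exact inv_anti₀ hδ (by linarith)
  have key : ∀ δ > 0, p ^ 3 ≤ ∫ x in A, h x * k x ∂μ + (2 * δ + δ ^ 2) := by
    intro δ hδ
    have i1 := (inv_int h δ hδ hm h0).integrableOn (s := A)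
    have i2 := (inv_int k δ hδ km k0).integrableOn (s := A)
    have i3 : IntegrableOn (fun x => (h x * k x + (2 * δ + δ ^ 2)) / p ^ 2) A μ :=
      ((ihk.add (integrable_const _)).div_const _).integrableOn
    have hmono : ∫ _ in A, (3 : ℝ) ∂μ ≤ ∫ x in A, ((h x * k x + (2 * δ + δ ^ 2)) / p ^ 2 +
        p * (h x + δ)⁻¹ + p * (k x + δ)⁻¹) ∂μ := by
      refine integral_mono (integrable_const _)
        ((i3.add (i1.const_mul p)).add (i2.const_mul p)) fun x => ?_
      have a0 := h0 x
      have b0 := k0 x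
      refine (three_le_of_pos hp (add_pos_of_nonneg_of_pos a0 hδ)
        (add_pos_of_nonneg_of_pos b0 hδ)).trans ?_
      -- Since `h, k ≤ 1`, `(h + δ)(k + δ) ≤ h k + 2 δ + δ²`.
      gcongr
      nlinarith [h1 x, k1 x]
    have i4 : IntegrableOn (fun x => (h x * k x + (2 * δ + δ ^ 2)) / p ^ 2 + p * (h x + δ)⁻¹) A μ :=
      i3.add (i1.const_mul p)
    rw [integral_add i4 (i2.const_mul p), integral_add i3 (i1.const_mul p),
      integral_const_mul, integral_const_mul, integral_div,
      integral_add ihk.integrableOn (integrable_const _), setIntegral_const, setIntegral_const,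
      smul_eq_mul, smul_eq_mul] at hmono
    have b1 := mul_le_mul_of_nonneg_left (hh δ hδ) hp.le
    have b2 := mul_le_mul_of_nonneg_left (hk δ hδ) hp.le
    have b3 : p ≤ (∫ x in A, h x * k x ∂μ + p * (2 * δ + δ ^ 2)) / p ^ 2 := by
      change p * 3 ≤ _ at hmono
      linarith
    rw [le_div_iff₀ (by positivity)] at b3
    have : p * (2 * δ + δ ^ 2) ≤ 1 * (2 * δ + δ ^ 2) := by gcongr
    linarith [show p * p ^ 2 = p ^ 3 by ring]
  refine le_of_forall_pos_le_add fun ε hε => ?_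
  -- With `δ ≤ 1` and `δ ≤ ε / 3`, `2 δ + δ² ≤ 3 δ ≤ ε`.
  have hδ : 0 < min 1 (ε / 3) := by positivity
  refine (key _ hδ).trans ?_
  have e1 := min_le_left 1 (ε / 3)
  have e2 := min_le_right 1 (ε / 3)
  nlinarith

/-- The translates of a measurable set under the iterates of an invertible measure preserving
transformation have a weak density along every idempotent ultrafilter. -/
theorem exists_iter_isWeakDensity {X : Type*} [MeasurableSpace X] {μ : Measure X}
    [IsProbabilityMeasure μ] {e : Ultrafilter ℤ} (he : e.IsAddIdempotent) {T : X ≃ᵐ X}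
    (hT : MeasurePreserving T μ μ) {B : Set X} (hB : MeasurableSet B) :
    ∃ h : X → ℝ, IsWeakDensity μ e (fun n => T.iter (-n) ⁻¹' B) h ∧
      ∀ δ > 0, ∫ x in B, (h x + δ)⁻¹ ∂μ ≤ 1 :=
  exists_isWeakDensity μ he (fun n => T.iter (-n)) (fun n => measurePreserving_iter T hT _)
    (fun _ => rfl) (fun m n x => by rw [neg_add_rev, measurableEquiv_iter_add]) hB

/-! ### Limits of triple intersections in a product -/

section Product

variable {X Y : Type*} [MeasurableSpace X] [MeasurableSpace Y] {μ : Measure X} {ν : Measure Y}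
  [IsProbabilityMeasure μ] [IsProbabilityMeasure ν] {e : Ultrafilter ℤ}
  {σ : ℤ → X → X} {τ : ℤ → Y → Y}

/-- Translates in the two coordinate directions of a product space are asymptotically
independent along an ultrafilter, in the sense that their weak densities multiply. -/
theorem tendsto_measure_inter_inter_of_isWeakDensity
    (hσ : ∀ n, MeasurePreserving (σ n) μ μ) (hτ : ∀ n, MeasurePreserving (τ n) ν ν)
    (hμ : ∀ b, MeasurableSet b → ∃ h, IsWeakDensity μ e (fun n => σ n ⁻¹' b) h)
    (hν : ∀ c, MeasurableSet c → ∃ k, IsWeakDensity ν e (fun n => τ n ⁻¹' c) k)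
    {h k : Set (X × Y) → X × Y → ℝ}
    (hh : ∀ B, MeasurableSet B →
      IsWeakDensity (μ.prod ν) e (fun n => Prod.map (σ n) id ⁻¹' B) (h B))
    (hk : ∀ C, MeasurableSet C →
      IsWeakDensity (μ.prod ν) e (fun n => Prod.map id (τ n) ⁻¹' C) (k C))
    {A B C : Set (X × Y)} (hA : MeasurableSet A) (hB : MeasurableSet B) (hC : MeasurableSet C) :
    Tendsto (fun n => (μ.prod ν).real
        (A ∩ Prod.map (σ n) id ⁻¹' B ∩ Prod.map id (τ n) ⁻¹' C)) e
      (𝓝 (∫ z in A, h B z * k C z ∂(μ.prod ν))) := by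
  have hσ' : ∀ n, MeasurePreserving (Prod.map (σ n) (id : Y → Y)) (μ.prod ν) (μ.prod ν) :=
    fun n => (hσ n).prod (.id ν)
  have hτ' : ∀ n, MeasurePreserving (Prod.map (id : X → X) (τ n)) (μ.prod ν) (μ.prod ν) :=
    fun n => (MeasurePreserving.id μ).prod (hτ n)
  have mB : ∀ n {B : Set (X × Y)}, MeasurableSet B → MeasurableSet (Prod.map (σ n) id ⁻¹' B) :=
    fun n _ hB => (hσ' n).measurable hB
  have mC : ∀ n {C : Set (X × Y)}, MeasurableSet C → MeasurableSet (Prod.map id (τ n) ⁻¹' C) :=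
    fun n _ hC => (hτ' n).measurable hC
  have hint : ∀ {B C}, MeasurableSet B → MeasurableSet C →
      Integrable (fun z => h B z * k C z) (μ.prod ν) := fun hB hC =>
    (hk _ hC).integrable.bdd_mul (hh _ hB).measurable.aestronglyMeasurable
      (.of_forall (hh _ hB).norm_le)
  have hhint : ∀ {B}, MeasurableSet B → ∫ z, h B z ∂(μ.prod ν) = (μ.prod ν).real B := fun hB =>
    (hh _ hB).integral_eq fun n => (hσ' n).measureReal_preimage hB.nullMeasurableSet
  have hkint : ∀ {C}, MeasurableSet C → ∫ z, k C z ∂(μ.prod ν) = (μ.prod ν).real C := fun hC =>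
    (hk _ hC).integral_eq fun n => (hτ' n).measureReal_preimage hC.nullMeasurableSet
  have hnn : ∀ {B C}, MeasurableSet B → MeasurableSet C → ∀ z, 0 ≤ h B z * k C z :=
    fun hB hC z => mul_nonneg ((hh _ hB).nonneg z) ((hk _ hC).nonneg z)
  have hadd : ∀ {s t}, MeasurableSet s → MeasurableSet t → Disjoint s t →
      h (s ∪ t) =ᵐ[μ.prod ν] fun z => h s z + h t z := fun hs ht hst =>
    (hh _ hs).ae_eq_add (hh _ ht) (hh _ (hs.union ht)) (fun n => mB n ht)
      (fun n => hst.preimage _) fun n => Set.preimage_union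
  have kadd : ∀ {s t}, MeasurableSet s → MeasurableSet t → Disjoint s t →
      k (s ∪ t) =ᵐ[μ.prod ν] fun z => k s z + k t z := fun hs ht hst =>
    (hk _ hs).ae_eq_add (hk _ ht) (hk _ (hs.union ht)) (fun n => mC n ht)
      (fun n => hst.preimage _) fun n => Set.preimage_union
  -- First the case where `B` and `C` are rectangles.
  have hrect : ∀ b₁ b₂ c₁ c₂, MeasurableSet b₁ → MeasurableSet b₂ → MeasurableSet c₁ →
      MeasurableSet c₂ → Tendsto (fun n => (μ.prod ν).real
        (A ∩ Prod.map (σ n) id ⁻¹' (b₁ ×ˢ b₂) ∩ Prod.map id (τ n) ⁻¹' (c₁ ×ˢ c₂))) e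
      (𝓝 (∫ z in A, h (b₁ ×ˢ b₂) z * k (c₁ ×ˢ c₂) z ∂(μ.prod ν))) := by
    intro b₁ b₂ c₁ c₂ hb₁ hb₂ hc₁ hc₂
    obtain ⟨f, hf⟩ := hμ b₁ hb₁
    obtain ⟨g, hg⟩ := hν c₂ hc₂
    have mb : ∀ n, MeasurableSet (σ n ⁻¹' b₁) := fun n => (hσ n).measurable hb₁
    have mc : ∀ n, MeasurableSet (τ n ⁻¹' c₂) := fun n => (hτ n).measurable hc₂
    have d1 := (hh _ (hb₁.prod hb₂)).ae_eq
      (hf.prod (IsWeakDensity.const (μ := ν) hb₂) mb fun _ => hb₂)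
    have d2 := (hk _ (hc₁.prod hc₂)).ae_eq
      ((IsWeakDensity.const (μ := μ) hc₁).prod hg (fun _ => hc₁) mc)
    -- The two translated rectangles meet in `(σ n ⁻¹' b₁ ∩ c₁) ×ˢ (τ n ⁻¹' c₂ ∩ b₂)`, whose density
    -- is the product of those in `d1` and `d2`.
    have d3 := (hf.inter_const hc₁).prod (hg.inter_const hb₂) (fun n => (mb n).inter hc₁)
      (fun n => (mc n).inter hb₂)
    have e1 : ∫ z in A, h (b₁ ×ˢ b₂) z * k (c₁ ×ˢ c₂) z ∂(μ.prod ν) =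
        ∫ z in A, c₁.indicator f z.1 * b₂.indicator g z.2 ∂(μ.prod ν) := by
      refine setIntegral_congr_ae hA ?_
      filter_upwards [d1, d2] with z h1 h2 _
      rw [h1, h2]
      by_cases m1 : z.1 ∈ c₁ <;> by_cases m2 : z.2 ∈ b₂ <;> simp [m1, m2]
    rw [e1]
    refine (d3.tendsto A hA).congr fun n => ?_
    congr 1
    ext z
    simp only [Set.mem_inter_iff, Set.mem_prod, Set.mem_preimage, Prod.map_fst, Prod.map_snd, id]
    tauto
  -- Then `B` arbitrary and `C` a rectangle.
  have hrect' : ∀ c₁ c₂, MeasurableSet c₁ → MeasurableSet c₂ → Tendsto (fun n => (μ.prod ν).real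
        (A ∩ Prod.map (σ n) id ⁻¹' B ∩ Prod.map id (τ n) ⁻¹' (c₁ ×ˢ c₂))) e
      (𝓝 (∫ z in A, h B z * k (c₁ ×ˢ c₂) z ∂(μ.prod ν))) := by
    intro c₁ c₂ hc₁ hc₂
    have hC := hc₁.prod hc₂
    refine tendsto_of_tendsto_rectangles (μ.prod ν)
      (fun n B => (μ.prod ν).real
        (A ∩ Prod.map (σ n) id ⁻¹' B ∩ Prod.map id (τ n) ⁻¹' (c₁ ×ˢ c₂)))
      (fun B => ∫ z in A, h B z * k (c₁ ×ˢ c₂) z ∂(μ.prod ν)) ?_ ?_ ?_ ?_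
      (fun s t hs ht => hrect s t c₁ c₂ hs ht hc₁ hc₂) hB
    · intro n s t hs ht hst
      rw [Set.preimage_union, Set.inter_union_distrib_left, Set.union_inter_distrib_right,
        measureReal_union _ ((hA.inter (mB n ht)).inter (mC n hC))]
      exact (hst.preimage _).mono (Set.inter_subset_left.trans Set.inter_subset_right)
        (Set.inter_subset_left.trans Set.inter_subset_right)
    · intro s t hs ht hst
      rw [← integral_add (hint hs hC).integrableOn (hint ht hC).integrableOn]
      refine setIntegral_congr_ae hA ?_
      filter_upwards [hadd hs ht hst] with z hz _
      rw [hz, add_mul]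
    -- Invariance of the measure gives a bound independent of `n`.
    · intro n s hs
      rw [abs_of_nonneg measureReal_nonneg, ← (hσ' n).measureReal_preimage hs.nullMeasurableSet]
      exact measureReal_mono (Set.inter_subset_left.trans Set.inter_subset_right)
    · intro s hs
      rw [abs_of_nonneg (integral_nonneg (hnn hs hC)), ← hhint hs]
      refine (setIntegral_le_integral (hint hs hC) (.of_forall (hnn hs hC))).trans ?_
      exact integral_mono (hint hs hC) (hh _ hs).integrable fun z =>
        mul_le_of_le_one_right ((hh _ hs).nonneg z) ((hk _ hC).le_one z)
  refine tendsto_of_tendsto_rectangles (μ.prod ν)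
    (fun n C => (μ.prod ν).real (A ∩ Prod.map (σ n) id ⁻¹' B ∩ Prod.map id (τ n) ⁻¹' C))
    (fun C => ∫ z in A, h B z * k C z ∂(μ.prod ν)) ?_ ?_ ?_ ?_ hrect' hC
  · intro n s t hs ht hst
    rw [Set.preimage_union, Set.inter_union_distrib_left,
      measureReal_union _ ((hA.inter (mB n hB)).inter (mC n ht))]
    exact (hst.preimage _).mono Set.inter_subset_right Set.inter_subset_right
  · intro s t hs ht hst
    rw [← integral_add (hint hB hs).integrableOn (hint hB ht).integrableOn]
    refine setIntegral_congr_ae hA ?_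
    filter_upwards [kadd hs ht hst] with z hz _
    rw [hz, mul_add]
  · intro n s hs
    rw [abs_of_nonneg measureReal_nonneg, ← (hτ' n).measureReal_preimage hs.nullMeasurableSet]
    exact measureReal_mono Set.inter_subset_right
  · intro s hs
    rw [abs_of_nonneg (integral_nonneg (hnn hB hs)), ← hkint hs]
    refine (setIntegral_le_integral (hint hB hs) (.of_forall (hnn hB hs))).trans ?_
    exact integral_mono (hint hB hs) (hk _ hs).integrable fun z =>
      mul_le_of_le_one_left ((hk _ hs).nonneg z) ((hh _ hB).le_one z)

end Product

/-! ### The main theorem -/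

theorem theorem1p3 {Y₁ Y₂ : Type*} [MeasurableSpace Y₁] [MeasurableSpace Y₂]
    (ν₁ : MeasureTheory.Measure Y₁) (ν₂ : MeasureTheory.Measure Y₂)
    [MeasureTheory.IsProbabilityMeasure ν₁] [MeasureTheory.IsProbabilityMeasure ν₂]
    (S₁ : Y₁ ≃ᵐ Y₁) (S₂ : Y₂ ≃ᵐ Y₂) (hS₁ : Ergodic S₁ ν₁) (hS₂ : Ergodic S₂ ν₂)
    (μ : MeasureTheory.Measure (Y₁ × Y₂)) (hμ : μ = ν₁.prod ν₂)
    (T₁ T₂ : (Y₁ × Y₂) ≃ᵐ (Y₁ × Y₂))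
    (hT₁ : T₁ = S₁.prodCongr (MeasurableEquiv.refl Y₂))
    (hT₂ : T₂ = (MeasurableEquiv.refl Y₁).prodCongr S₂)
    (A : Set (Y₁ × Y₂)) (hA : MeasurableSet A) (hA_pos : 0 < μ A)
    (ε : ℝ) (hε : 0 < ε) :
    IsSyndetic {n : ℤ | μ.real (A ∩ T₁.iter n '' A ∩ T₂.iter n '' A) > μ.real A ^ 3 - ε} := by
  subst hμ
  have hT₁p : MeasurePreserving T₁ (ν₁.prod ν₂) (ν₁.prod ν₂) := by
    rw [hT₁]; exact hS₁.toMeasurePreserving.prod (.id ν₂)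
  have hT₂p : MeasurePreserving T₂ (ν₁.prod ν₂) (ν₁.prod ν₂) := by
    rw [hT₂]; exact (MeasurePreserving.id ν₁).prod hS₂.toMeasurePreserving
  have hi₁ : ∀ n, ⇑(T₁.iter n) = Prod.map (S₁.iter n) id :=
    fun n => by rw [hT₁, iter_prodCongr, iter_refl]
  have hi₂ : ∀ n, ⇑(T₂.iter n) = Prod.map id (S₂.iter n) :=
    fun n => by rw [hT₂, iter_prodCongr, iter_refl]
  refine isSyndetic_of_forall_isAddIdempotent fun e he => ?_
  choose! h hh hhle using fun B => exists_iter_isWeakDensity he hT₁p (B := B)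
  choose! k hk hkle using fun B => exists_iter_isWeakDensity he hT₂p (B := B)
  -- The exponent is `-n` because the image under `T^n` is the preimage under `T^(-n)`.
  have hlim := tendsto_measure_inter_inter_of_isWeakDensity (e := e)
    (fun n => measurePreserving_iter S₁ hS₁.toMeasurePreserving (-n))
    (fun n => measurePreserving_iter S₂ hS₂.toMeasurePreserving (-n))
    (fun b hb => (exists_iter_isWeakDensity he hS₁.toMeasurePreserving hb).imp fun _ => And.left)
    (fun c hc => (exists_iter_isWeakDensity he hS₂.toMeasurePreserving hc).imp fun _ => And.left)
    (h := h) (k := k) (fun B hB => by simpa only [hi₁] using hh B hB)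
    (fun C hC => by simpa only [hi₂] using hk C hC) hA hA hA
  have hge := pow_three_le_setIntegral_mul (μ := ν₁.prod ν₂) (A := A) (hh A hA).measurable
    (hk A hA).measurable (hh A hA).nonneg (hk A hA).nonneg (hh A hA).le_one (hk A hA).le_one
    (hhle A hA) (hkle A hA)
  have hev := hlim.eventually (lt_mem_nhds (show (ν₁.prod ν₂).real A ^ 3 - ε < _ by linarith))
  filter_upwards [hev] with n hn
  change _ < _
  rw [iter_image, iter_image, hi₁, hi₂]
  exact hn
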